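/- Let $\omega=\{0,1,2,\dots\}$ be discrete, let $\mathbf S=\omega\times[0,1]^2$, and let $\beta$ denote the Čech–Stone compactification. Let $\beta\pi:\beta\mathbf S\to\beta\omega$ and $\beta f:\beta\mathbf S\to[0,1]$ be the continuous extensions of $\pi(n,x,y)=n$ and $f(n,x,y)=x$. A space is an $F$-space if every cozero-set in it is $C^*$-embedded. For a real-valued function $h$ on a space $Y$ put $\Omega_h=\bigcup_{t\in\mathbb R}\operatorname{Int}_Y h^{-1}(t)$. Let $u$ be any free ultrafilter on $\omega$. Put $S_u=\beta\pi^{-1}(u)$, let $f_u$ be the restriction of $\beta f$ to $S_u$, and put $$B_u=S_u\cap\operatorname{cl}_{\beta\mathbf S}(\omega\times[0,1]\times\{0\}),\qquad T_u=S_u\cap\operatorname{cl}_{\beta\mathbf S}(\omega\times[0,1]\times\{1\}).$$ Define closed sets $X_\alpha$ by recursion on the ordinals: $X_0=S_u$; $X_{\alpha+1}=X_\alpha\setminus\bigcup_t\operatorname{Int}_{X_\alpha}(f_u\restriction X_\alpha)^{-1}(t)$; and $X_\alpha=\bigcap_{\beta<\alpha}X_\beta$ for limit $\alpha$. Then there is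 a least ordinal $\delta$ with $X_\delta=X_{\delta+1}$. The subspace $K=B_u\cup X_\delta$ of $S_u$ is a compact connected Hausdorff $F$-space that meets $T_u$. The function $g=f_u\restriction K$ is continuous and $\Omega_g\subseteq B_u$. The set $B_u$ is not dense in $K$, and hence $\Omega_g$ is not dense in $K$. In particular, there are a compact connected Hausdorff $F$-space $K$ and a continuous function $g:K\to\mathbb R$ such that $\Omega_g$ is not dense in $K$, which answers Problem 4 of Abramovich and Kitover (d-Independence and d-bases, Positivity 7 (2003)) positively. -/

import Mathlib

open Set Topology BoundedContinuousFunction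

noncomputable section

namespace ConnectedFSpace

/-- `Ω_g`, the union over all real `t` of the interiors (in the space `X`) of the fibers of `g`. -/
def Omega {X : Type*} [TopologicalSpace X] (g : X → ℝ) : Set X :=
  ⋃ t : ℝ, interior (g ⁻¹' {t})

/-- `X` is an `F`-space: every cozero-set of `X` is `C*`-embedded, that is, every bounded
continuous real-valued function on the cozero-set `{x | φ x ≠ 0}` of a continuous `φ : X → ℝ`
extends to a bounded continuous real-valued function on `X`. -/
def IsFSpace (X : Type*) [TopologicalSpace X] : Prop :=
  ∀ (φ : C(X, ℝ)) (h : {x : X // φ x ≠ 0} →ᵇ ℝ),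
    ∃ H : X →ᵇ ℝ, ∀ x : {x : X // φ x ≠ 0}, H x = h x

/-- The product `ω × [0,1]²`, with `ω = ℕ` discrete. -/
abbrev Squares : Type := ℕ × (unitInterval × unitInterval)

/-- The Čech–Stone compactification `β(ω × [0,1]²)`. -/
abbrev BetaSquares : Type := StoneCech Squares

/-- The map `(n, x, y) ↦ n` from `ω × [0,1]²` to `ω ⊆ βω`, where `βω` is the compact Hausdorff
space of all ultrafilters on `ℕ` and `n` is identified with the principal ultrafilter at `n`. -/
def proj (p : Squares) : Ultrafilter ℕ := pure p.1

theorem continuous_proj : Continuous proj :=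
  (continuous_of_discreteTopology (f := fun n : ℕ => (pure n : Ultrafilter ℕ))).comp
    continuous_fst

/-- The extension `βπ : β(ω × [0,1]²) → βω`. -/
def betaProj : BetaSquares → Ultrafilter ℕ := stoneCechExtend continuous_proj

/-- The first-coordinate function `(n, x, y) ↦ x` from `ω × [0,1]²` to `[0,1]`. -/
def firstCoord (p : Squares) : unitInterval := p.2.1

theorem continuous_firstCoord : Continuous firstCoord :=
  continuous_fst.comp continuous_snd

/-- The extension `βf : β(ω × [0,1]²) → [0,1]` of the first-coordinate function, regarded as a
real-valued function. -/
def betaFirst (p : BetaSquares) : ℝ := (stoneCechExtend continuous_firstCoord p : unitInterval)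

/-- The fiber `S_u` of `βπ` over `u`. -/
def fiber (u : Ultrafilter ℕ) : Set BetaSquares := betaProj ⁻¹' {u}

/-- The bottom line `B_u`. -/
def bottomLine (u : Ultrafilter ℕ) : Set BetaSquares :=
  fiber u ∩ closure (stoneCechUnit '' {p : Squares | p.2.2 = 0})

/-- The top line `T_u`. -/
def topLine (u : Ultrafilter ℕ) : Set BetaSquares :=
  fiber u ∩ closure (stoneCechUnit '' {p : Squares | p.2.2 = 1})

/-- One step of the recursion: remove from `A` the interiors, taken in the subspace `A`, of all
fibers of the restriction of `βf` to `A`. -/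
def removeInteriors (A : Set BetaSquares) : Set BetaSquares :=
  A \ (Subtype.val '' Omega (fun x : A => betaFirst x))

/-- The decreasing sequence `X_α`: `X_0 = S_u`, `X_{α+1}` is obtained from `X_α` by removing the
relative interiors of the fibers, and `X_α = ⋂_{β < α} X_β` at limits. -/
def X (u : Ultrafilter ℕ) (α : Ordinal.{0}) : Set BetaSquares :=
  Ordinal.limitRecOn α (fiber u) (fun _ A => removeInteriors A)
    (fun α _ A => ⋂ (β : Ordinal.{0}) (h : β < α), A β h)

theorem X_zero (u : Ultrafilter ℕ) : X u 0 = fiber u :=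
  Ordinal.limitRecOn_zero ..

theorem X_add_one (u : Ultrafilter ℕ) (α : Ordinal.{0}) :
    X u (α + 1) = removeInteriors (X u α) :=
  Ordinal.limitRecOn_add_one ..

theorem X_limit (u : Ultrafilter ℕ) (α : Ordinal.{0}) (hα : Order.IsSuccLimit α) :
    X u α = ⋂ (β : Ordinal.{0}) (_ : β < α), X u β :=
  Ordinal.limitRecOn_limit _ _ _ _ hα

/-- The least ordinal `δ` with `X_δ = X_{δ+1}`. -/
def delta (u : Ultrafilter ℕ) : Ordinal.{0} := sInf {α | X u α = X u (α + 1)}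

/-- The space `K = B_u ∪ X_δ`. -/
def K (u : Ultrafilter ℕ) : Set BetaSquares := bottomLine u ∪ X u (delta u)

/-- The function `g`, the restriction of `βf` to `K`. As `K ⊆ S_u`, this is the restriction to `K`
of `f_u`, the restriction of `βf` to `S_u`. -/
def g (u : Ultrafilter ℕ) : K u → ℝ := fun x => betaFirst x

end ConnectedFSpace

end

/-! Everything rests on the extension `collapse` : β(ω × [0,1]²) → β(ω × [0,1]) of (n, x, y) ↦ (n,
x). It is open, has connected fibers, and βf factors through it. Hence removing relative interiors
of fibers of βf preserves saturated sets (unions of fibers of `collapse`), and every X_α is closed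
and saturated. Each fiber of `collapse` in X_δ is connected and meets both B_u and T_u; as B_u is
connected, so is K.

The recursion must not exhaust S_u. Call a set negligible if the Lebesgue measure of its trace on
the n-th square tends to 0 along u. The points without negligible neighborhoods form a nonempty set
in S_u (`support`). Thin vertical strips have small measure, so βf is nowhere locally constant on
this set, and it survives every step.

Since X_δ is fixed by the removal, a point of K outside B_u has no neighborhood on which g is
constant, so Ω_g ⊆ B_u. The closed set B_u misses T_u while K does not, so B_u is not dense. The
F-property holds for every closed subset of S_u, by extending functions one square at a time. -/

noncomputable section

namespace ConnectedFSpace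

open Filter MeasureTheory unitInterval

/-! ### Extensions of projections with compact fibers: openness and connected fibers. -/

section FiberMaps

variable {W C E Z : Type*} [TopologicalSpace W] [TopologicalSpace C] [TopologicalSpace E]
  [TopologicalSpace Z] [CompactSpace C]

/-- Let `Q : E → Z` extend the projection `W × C → W` with `C` compact, and suppose that bounded
continuous functions extend from `W` to `Z`. Then the fiberwise supremum of a continuous function on
`E` is dominated by a continuous function on `Z` that is attained on the fibers over `W`. -/
theorem exists_fiberwise_sup [Nonempty C] {e : W × C → E} (he : Continuous e) (hed : DenseRange e)
    {j : W → Z} {Q : E → Z} (hQ : Continuous Q) (hQe : ∀ w c, Q (e (w, c)) = j w)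
    (hext : ∀ ψ : C(W, ℝ), (∀ w, ψ w ∈ Icc (0 : ℝ) 1) → ∃ Ψ : C(Z, ℝ), ∀ w, Ψ (j w) = ψ w)
    (Φ : C(E, ℝ)) (hΦ : ∀ z, Φ z ∈ Icc (0 : ℝ) 1) :
    ∃ Ψ : C(Z, ℝ), (∀ z, Φ z ≤ Ψ (Q z)) ∧ ∀ w, ∃ c, Φ (e (w, c)) = Ψ (j w) := by
  have hcont : Continuous fun w => sSup ((fun c => Φ (e (w, c))) '' (univ : Set C)) :=
    isCompact_univ.continuous_sSup (f := fun w c => Φ (e (w, c))) (Φ.continuous.comp he)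
  have hatt (w : W) : ∃ c, Φ (e (w, c)) = sSup ((fun c => Φ (e (w, c))) '' (univ : Set C)) := by
    obtain ⟨c, -, hc, -⟩ := isCompact_univ.exists_sSup_image_eq_and_ge univ_nonempty
      (f := fun c => Φ (e (w, c))) (by fun_prop)
    exact ⟨c, hc.symm⟩
  obtain ⟨Ψ, hΨ⟩ := hext ⟨_, hcont⟩ fun w => by
    obtain ⟨c, hc⟩ := hatt w
    exact hc.subst (motive := (· ∈ Icc (0 : ℝ) 1)) (hΦ _)
  refine ⟨Ψ, fun z => ?_, fun w => (hΨ w).symm ▸ hatt w⟩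
  have hcl : IsClosed {z | Φ z ≤ Ψ (Q z)} :=
    isClosed_le Φ.continuous (Ψ.continuous.comp hQ)
  refine hed.induction_on (p := fun z => Φ z ≤ Ψ (Q z)) z hcl ?_
  rintro ⟨w, c⟩
  rw [hQe, hΨ]
  refine le_csSup ⟨1, ?_⟩ ⟨c, mem_univ c, rfl⟩
  rintro _ ⟨c, -, rfl⟩
  exact (hΦ _).2

variable [CompactSpace E] [T2Space E] [T2Space Z]

/-- An extension to compactifications of a projection with compact fibers is an open map. -/
theorem isOpenMap_of_extends_projection [Nonempty C] {e : W × C → E} (he : Continuous e)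
    (hed : DenseRange e) {j : W → Z} (hj : DenseRange j) {Q : E → Z} (hQ : Continuous Q)
    (hQe : ∀ w c, Q (e (w, c)) = j w)
    (hext : ∀ ψ : C(W, ℝ), (∀ w, ψ w ∈ Icc (0 : ℝ) 1) → ∃ Ψ : C(Z, ℝ), ∀ w, Ψ (j w) = ψ w) :
    IsOpenMap Q := by
  refine fun U hU => isOpen_iff_mem_nhds.2 ?_
  rintro _ ⟨z, hz, rfl⟩
  obtain ⟨Φ, hΦ0, hΦ1, hΦ⟩ := exists_continuous_zero_one_of_isClosed hU.isClosed_compl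
    isClosed_singleton (disjoint_singleton_right.2 fun h => h hz)
  obtain ⟨Ψ, hle, hatt⟩ := exists_fiberwise_sup he hed hQ hQe hext Φ hΦ
  have hV : IsOpen {r | 1 / 2 < Ψ r} := isOpen_lt continuous_const Ψ.continuous
  have hF : IsClosed (Q '' {z | 1 / 2 ≤ Φ z}) :=
    ((isClosed_le continuous_const Φ.continuous).isCompact.image hQ).isClosed
  refine mem_of_superset (hV.mem_nhds ?_) (?_ : _ ⊆ Q '' U)
  · have h1 : Φ z = 1 := hΦ1 rfl
    have := hle z
    simp only [mem_ofPred_eq]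
    linarith
  · have hsub : Q '' {z | 1 / 2 ≤ Φ z} ⊆ Q '' U := image_mono fun y hy => by
      by_contra hyU
      have h0 : Φ y = 0 := hΦ0 hyU
      have hy' : 1 / 2 ≤ Φ y := hy
      linarith
    -- The open set {1/2 < Ψ} lies in the closure of its points coming from `W`. Each of these is
    -- the image of a point with 1/2 ≤ Φ, and that image is closed by compactness.
    refine Subset.trans ?_ hsub
    refine (hj.open_subset_closure_inter hV).trans (hF.closure_subset_iff.2 ?_)
    rintro _ ⟨hw, w, rfl⟩
    obtain ⟨c, hc⟩ := hatt w
    exact ⟨e (w, c), (le_of_lt hw).trans_eq hc.symm, hQe w c⟩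

/-- An extension to compactifications of a projection with compact connected fibers has connected
fibers. -/
theorem isPreconnected_fiber_of_extends_projection [ConnectedSpace C] {e : W × C → E}
    (he : Continuous e) (hed : DenseRange e) {j : W → Z} (hj : DenseRange j) {Q : E → Z}
    (hQ : Continuous Q) (hQe : ∀ w c, Q (e (w, c)) = j w)
    (hext : ∀ ψ : C(W, ℝ), (∀ w, ψ w ∈ Icc (0 : ℝ) 1) → ∃ Ψ : C(Z, ℝ), ∀ w, Ψ (j w) = ψ w)
    (r : Z) : IsPreconnected (Q ⁻¹' {r}) := by
  rw [isPreconnected_closed_iff]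
  rintro A B hA hB hAB ⟨a, har, haA⟩ ⟨b, hbr, hbB⟩
  by_contra hdis
  have hr : IsClosed (Q ⁻¹' {r}) := isClosed_singleton.preimage hQ
  obtain ⟨Φ, hΦ0, hΦ1, hΦ⟩ := exists_continuous_zero_one_of_isClosed (hr.inter hA) (hr.inter hB)
    (disjoint_left.2 fun z hz hz' => hdis ⟨z, hz.1, hz.2, hz'.2⟩)
  obtain ⟨Ψ, hle, hatt⟩ := exists_fiberwise_sup he hed hQ hQe hext Φ hΦ
  -- Using both Φ and 1 - Φ makes Φ take values on both sides of 1/2 in fibers over points of `W`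
  -- near `r`. The intermediate value theorem gives the value 1/2 there, and compactness carries it
  -- to the fiber over `r`.
  obtain ⟨Ψ', hle', hatt'⟩ := exists_fiberwise_sup he hed hQ hQe hext (1 - Φ) fun z => by
    have := hΦ z
    simp only [ContinuousMap.sub_apply, ContinuousMap.one_apply, mem_Icc] at this ⊢
    constructor <;> linarith
  have hV : IsOpen ({r | 1 / 2 < Ψ r} ∩ {r | 1 / 2 < Ψ' r}) :=
    (isOpen_lt continuous_const Ψ.continuous).inter (isOpen_lt continuous_const Ψ'.continuous)
  have hF : IsClosed (Q '' {z | Φ z = 1 / 2}) :=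
    ((isClosed_eq Φ.continuous continuous_const).isCompact.image hQ).isClosed
  have hrV : r ∈ {r | 1 / 2 < Ψ r} ∩ {r | 1 / 2 < Ψ' r} := by
    have h1 : Φ b = 1 := hΦ1 ⟨hbr, hbB⟩
    have h0 : Φ a = 0 := hΦ0 ⟨har, haA⟩
    have hb := hle b
    have ha := hle' a
    rw [mem_preimage, mem_singleton_iff] at har hbr
    simp only [ContinuousMap.sub_apply, ContinuousMap.one_apply, har, hbr] at ha hb
    constructor <;> simp only [mem_ofPred_eq] <;> linarith
  obtain ⟨z, hz, hzr⟩ : r ∈ Q '' {z | Φ z = 1 / 2} := by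
    refine (hj.open_subset_closure_inter hV).trans (hF.closure_subset_iff.2 ?_) hrV
    rintro _ ⟨⟨hw, hw'⟩, w, rfl⟩
    obtain ⟨c, hc⟩ := hatt w
    obtain ⟨c', hc'⟩ := hatt' w
    simp only [ContinuousMap.sub_apply, ContinuousMap.one_apply, mem_ofPred_eq] at hw hw' hc'
    obtain ⟨d, hd⟩ := mem_range_of_exists_le_of_exists_ge (c := (1 / 2 : ℝ))
      (f := fun c => Φ (e (w, c))) (by fun_prop) ⟨c', by linarith⟩ ⟨c, by linarith⟩
    exact ⟨e (w, d), hd, hQe w d⟩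
  have hz : Φ z = 1 / 2 := hz
  rcases hAB (show z ∈ Q ⁻¹' {r} from hzr) with h | h
  · have := hΦ0 ⟨hzr, h⟩
    simp only [Pi.zero_apply] at this
    linarith
  · have := hΦ1 ⟨hzr, h⟩
    simp only [Pi.one_apply] at this
    linarith

end FiberMaps

/-! ### The collapse map, its horizontal sections, and the bottom and top lines. -/

theorem exists_stoneCech_extension {W : Type*} [TopologicalSpace W] (ψ : C(W, ℝ)) {a b : ℝ}
    (hψ : ∀ w, ψ w ∈ Icc a b) :
    ∃ Ψ : C(StoneCech W, ℝ), ∀ w, Ψ (stoneCechUnit w) = ψ w := by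
  have hc : Continuous fun w => (⟨ψ w, hψ w⟩ : Icc a b) := ψ.continuous.subtype_mk hψ
  exact ⟨⟨fun z => (stoneCechExtend hc z : Icc a b),
    continuous_subtype_val.comp (continuous_stoneCechExtend hc)⟩, fun w => by simp⟩

theorem exists_ultrafilter_extension (ψ : C(ℕ, ℝ)) (hψ : ∀ w, ψ w ∈ Icc (0 : ℝ) 1) :
    ∃ Ψ : C(Ultrafilter ℕ, ℝ), ∀ w, Ψ (pure w) = ψ w :=
  ⟨⟨fun z => (Ultrafilter.extend (fun w => (⟨ψ w, hψ w⟩ : Icc (0 : ℝ) 1)) z : Icc (0 : ℝ) 1),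
    continuous_subtype_val.comp (continuous_ultrafilter_extend _)⟩, fun w => by simp⟩

theorem continuous_betaProj : Continuous betaProj := continuous_stoneCechExtend _

@[simp]
theorem betaProj_unit (p : Squares) : betaProj (stoneCechUnit p) = pure p.1 :=
  stoneCechExtend_stoneCechUnit _ p

theorem continuous_betaFirst : Continuous betaFirst :=
  continuous_subtype_val.comp (continuous_stoneCechExtend _)

@[simp]
theorem betaFirst_unit (p : Squares) : betaFirst (stoneCechUnit p) = p.2.1 := by
  simp [betaFirst, firstCoord]

theorem isClosed_fiber (u : Ultrafilter ℕ) : IsClosed (fiber u) :=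
  isClosed_singleton.preimage continuous_betaProj

/-- The space `β(ω × [0,1])`. -/
abbrev BetaIntervals : Type := StoneCech (ℕ × I)

/-- The extension `β(ω × [0,1]²) → β(ω × [0,1])` of `(n, x, y) ↦ (n, x)`. -/
def collapse : BetaSquares → BetaIntervals :=
  stoneCechExtend (g := fun p : Squares => stoneCechUnit (p.1, p.2.1))
    (continuous_stoneCechUnit.comp (by fun_prop))

theorem continuous_collapse : Continuous collapse := continuous_stoneCechExtend _

@[simp]
theorem collapse_unit (p : Squares) : collapse (stoneCechUnit p) = stoneCechUnit (p.1, p.2.1) :=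
  stoneCechExtend_stoneCechUnit _ p

/-- The extension `β(ω × [0,1]) → βω` of the projection. -/
def intervalProj : BetaIntervals → Ultrafilter ℕ :=
  stoneCechExtend (g := fun p : ℕ × I => (pure p.1 : Ultrafilter ℕ))
    ((continuous_of_discreteTopology (f := fun n : ℕ => (pure n : Ultrafilter ℕ))).comp
      continuous_fst)

theorem continuous_intervalProj : Continuous intervalProj := continuous_stoneCechExtend _

@[simp]
theorem intervalProj_unit (p : ℕ × I) : intervalProj (stoneCechUnit p) = pure p.1 :=
  stoneCechExtend_stoneCechUnit _ p

theorem intervalProj_collapse (z : BetaSquares) : intervalProj (collapse z) = betaProj z :=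
  congr_fun (stoneCech_hom_ext (continuous_intervalProj.comp continuous_collapse)
    continuous_betaProj (by ext1 p; simp)) z

theorem betaFirst_eq_of_collapse_eq {z z' : BetaSquares} (h : collapse z = collapse z') :
    betaFirst z = betaFirst z' := by
  have key : betaFirst = fun z => ((stoneCechExtend (g := fun p : ℕ × I => p.2) continuous_snd
      (collapse z) : I) : ℝ) :=
    stoneCech_hom_ext continuous_betaFirst (continuous_subtype_val.comp
      ((continuous_stoneCechExtend _).comp continuous_collapse)) (by ext1 p; simp)
  rw [key]
  simp only [h]

/-- Reassociating presents ω × [0,1]² as `W` × `C` with `W` = ω × [0,1] and `C` = [0,1], the form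
required by the results on projections. -/
theorem continuous_assoc : Continuous fun p : (ℕ × I) × I => (p.1.1, (p.1.2, p.2)) := by
  fun_prop

theorem denseRange_unit_assoc :
    DenseRange fun p : (ℕ × I) × I => (stoneCechUnit (p.1.1, (p.1.2, p.2)) : BetaSquares) :=
  denseRange_stoneCechUnit.comp
    (Function.Surjective.denseRange fun p => ⟨((p.1, p.2.1), p.2.2), rfl⟩)
    continuous_stoneCechUnit

theorem isOpenMap_collapse : IsOpenMap collapse :=
  isOpenMap_of_extends_projection (continuous_stoneCechUnit.comp continuous_assoc)
    denseRange_unit_assoc denseRange_stoneCechUnit continuous_collapse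
    (fun _ _ => collapse_unit _) fun ψ hψ => exists_stoneCech_extension ψ hψ

theorem isPreconnected_collapse_fiber (r : BetaIntervals) : IsPreconnected (collapse ⁻¹' {r}) :=
  isPreconnected_fiber_of_extends_projection (continuous_stoneCechUnit.comp continuous_assoc)
    denseRange_unit_assoc denseRange_stoneCechUnit continuous_collapse
    (fun _ _ => collapse_unit _) (fun ψ hψ => exists_stoneCech_extension ψ hψ) r

theorem isPreconnected_intervalProj_fiber (u : Ultrafilter ℕ) :
    IsPreconnected (intervalProj ⁻¹' {u}) :=
  isPreconnected_fiber_of_extends_projection (e := stoneCechUnit) continuous_stoneCechUnit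
    denseRange_stoneCechUnit denseRange_pure continuous_intervalProj
    (fun _ _ => intervalProj_unit _) exists_ultrafilter_extension u

/-- The section of `collapse` with constant second coordinate `y`. -/
def level (y : I) : BetaIntervals → BetaSquares :=
  stoneCechExtend (g := fun p : ℕ × I => (stoneCechUnit (p.1, (p.2, y)) : BetaSquares))
    (continuous_stoneCechUnit.comp (by fun_prop))

theorem continuous_level (y : I) : Continuous (level y) := continuous_stoneCechExtend _

@[simp]
theorem level_unit (y : I) (p : ℕ × I) : level y (stoneCechUnit p) = stoneCechUnit (p.1, (p.2, y)) :=
  stoneCechExtend_stoneCechUnit _ p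

@[simp]
theorem collapse_level (y : I) (r : BetaIntervals) : collapse (level y r) = r :=
  congr_fun (stoneCech_hom_ext (continuous_collapse.comp (continuous_level y)) continuous_id
    (by ext1 p; simp)) r

theorem level_mem_closure (y : I) (r : BetaIntervals) :
    level y r ∈ closure (stoneCechUnit '' {p : Squares | p.2.2 = y}) := by
  refine denseRange_stoneCechUnit.induction_on (p := fun r => level y r ∈ closure _) r
    (isClosed_closure.preimage (continuous_level y)) fun p => subset_closure ?_
  exact ⟨(p.1, (p.2, y)), rfl, (level_unit y p).symm⟩

theorem level_collapse_of_mem_closure {y : I} {z : BetaSquares}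
    (hz : z ∈ closure (stoneCechUnit '' {p : Squares | p.2.2 = y})) :
    level y (collapse z) = z := by
  have hcl : IsClosed {z | level y (collapse z) = z} :=
    isClosed_eq ((continuous_level y).comp continuous_collapse) continuous_id
  refine hcl.closure_subset_iff.2 ?_ hz
  rintro _ ⟨⟨n, x, y⟩, rfl, rfl⟩
  simp

theorem level_zero_mem_bottomLine {u : Ultrafilter ℕ} {r : BetaIntervals}
    (hr : intervalProj r = u) : level 0 r ∈ bottomLine u :=
  ⟨by simp [fiber, ← intervalProj_collapse, hr], level_mem_closure 0 r⟩

theorem level_one_mem_topLine {u : Ultrafilter ℕ} {r : BetaIntervals}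
    (hr : intervalProj r = u) : level 1 r ∈ topLine u :=
  ⟨by simp [fiber, ← intervalProj_collapse, hr], level_mem_closure 1 r⟩

theorem isClosed_bottomLine (u : Ultrafilter ℕ) : IsClosed (bottomLine u) :=
  (isClosed_fiber u).inter isClosed_closure

theorem isPreconnected_bottomLine (u : Ultrafilter ℕ) : IsPreconnected (bottomLine u) := by
  have h : bottomLine u = level 0 '' (intervalProj ⁻¹' {u}) := by
    ext z
    constructor
    · rintro ⟨hz, hz'⟩
      exact ⟨collapse z, by rwa [mem_preimage, intervalProj_collapse],
        level_collapse_of_mem_closure hz'⟩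
    · rintro ⟨r, hr, rfl⟩
      exact level_zero_mem_bottomLine hr
  rw [h]
  exact (isPreconnected_intervalProj_fiber u).image _ (continuous_level 0).continuousOn

/-- The extension of the second coordinate is 0 on one line and 1 on the other. -/
theorem disjoint_bottomLine_topLine (u : Ultrafilter ℕ) :
    Disjoint (bottomLine u) (topLine u) := by
  have hc : Continuous fun p : Squares => p.2.2 := by fun_prop
  have hval (y : I) : closure (stoneCechUnit '' {p : Squares | p.2.2 = y}) ⊆
      {z | stoneCechExtend hc z = y} := by
    refine (isClosed_eq (continuous_stoneCechExtend hc) continuous_const).closure_subset_iff.2 ?_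
    rintro _ ⟨p, hp, rfl⟩
    simpa using hp
  refine disjoint_left.2 fun z hz hz' => ?_
  have h0 : stoneCechExtend hc z = 0 := hval 0 hz.2
  have h1 : stoneCechExtend hc z = 1 := hval 1 hz'.2
  exact zero_ne_one (h0.symm.trans h1)

/-! ### Closed subsets of S_u are F-spaces. -/

section FSpace

/-- A bounded continuous function on a cozero-set of `β(ω × [0,1]²)` agrees on the fiber over a free
ultrafilter with a continuous function on the whole space. -/
theorem exists_continuous_eq_on_fiber {u : Ultrafilter ℕ} (hu : ∀ n : ℕ, u ≠ pure n)
    (φ : C(BetaSquares, ℝ)) (h : {z : BetaSquares // φ z ≠ 0} →ᵇ ℝ) :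
    ∃ H : C(BetaSquares, ℝ), ∀ z : {z : BetaSquares // φ z ≠ 0}, z.1 ∈ fiber u → H z = h z := by
  have hcont (n : ℕ) : Continuous fun p : I × I => (stoneCechUnit (n, p) : BetaSquares) :=
    continuous_stoneCechUnit.comp (by fun_prop)
  -- Each `D n` is closed in a square, so Tietze applies there. The threshold tends to 0, so near a
  -- point of the fiber over a free ultrafilter with φ ≠ 0 the sets `D n` eventually contain
  -- everything relevant.
  let D (n : ℕ) : Set (I × I) := {p | 1 / ((n : ℝ) + 1) ≤ |φ (stoneCechUnit (n, p))|}
  have hD (n : ℕ) : IsClosed (D n) :=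
    isClosed_le continuous_const (φ.continuous.comp (hcont n)).abs
  have hne (n : ℕ) (p : D n) : φ (stoneCechUnit (n, p.1)) ≠ 0 :=
    abs_pos.1 (lt_of_lt_of_le (by positivity) p.2)
  have hext (n : ℕ) : ∃ G : (I × I) →ᵇ ℝ, ‖G‖ ≤ ‖h‖ ∧
      ∀ p : D n, G p.1 = h ⟨stoneCechUnit (n, p.1), hne n p⟩ := by
    let e : C(D n, {z : BetaSquares // φ z ≠ 0}) :=
      ⟨fun p => ⟨stoneCechUnit (n, p.1), hne n p⟩,
        ((hcont n).comp continuous_subtype_val).subtype_mk _⟩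
    obtain ⟨G, hG, hGr⟩ := exists_norm_eq_domRestrict_eq_of_closed (h.compContinuous e) (hD n)
    exact ⟨G, hG.trans_le (norm_compContinuous_le h e), fun p => DFunLike.congr_fun hGr p⟩
  choose G hG hGh using hext
  have hGc : Continuous fun p : Squares => G p.1 p.2 :=
    continuous_prod_of_discrete_left.2 fun n => (G n).continuous
  obtain ⟨H, hH⟩ := exists_stoneCech_extension (a := -‖h‖) (b := ‖h‖) ⟨_, hGc⟩ fun p =>
    abs_le.1 (((G p.1).norm_coe_le_norm p.2).trans (hG p.1))
  refine ⟨H, fun z hz => ?_⟩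
  have hpos : 0 < |φ z.1| := abs_pos.2 z.2
  obtain ⟨m, hm⟩ := exists_nat_one_div_lt (half_pos hpos)
  have hV : IsOpen ({y : BetaSquares | |φ z.1| / 2 < |φ y|} ∩
      betaProj ⁻¹' {v | Ici m ∈ v}) :=
    (isOpen_lt continuous_const φ.continuous.abs).inter
      ((ultrafilter_isOpen_basic _).preimage continuous_betaProj)
  have hzV : z.1 ∈ {y : BetaSquares | |φ z.1| / 2 < |φ y|} ∩
      betaProj ⁻¹' {v | Ici m ∈ v} := by
    refine ⟨half_lt_self hpos, ?_⟩
    have hzu : betaProj z.1 = u := hz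
    simp only [mem_preimage, mem_ofPred_eq, hzu]
    have hcof : (u : Filter ℕ) ≤ cofinite := by
      rcases u.le_cofinite_or_eq_pure with h | ⟨n, hn⟩
      · exact h
      · exact absurd hn (hu n)
    exact hcof (by rw [Nat.cofinite_eq_atTop]; exact Ici_mem_atTop m)
  by_contra hHz
  have hO : IsOpen {y : {z : BetaSquares // φ z ≠ 0} | H y.1 ≠ h y} :=
    isOpen_ne_fun (H.continuous.comp continuous_subtype_val) h.continuous
  obtain ⟨O, hO1, hO2⟩ := isOpen_induced_iff.1 hO
  have hzO : z.1 ∈ O := by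
    have : z ∈ Subtype.val ⁻¹' O := hO2 ▸ hHz
    exact this
  -- If H and h differed at `z`, they would differ at some nearby (n, p) with n ≥ m. There |φ| > |φ
  -- z| / 2 > 1/(m+1) ≥ 1/(n+1), so p ∈ `D n`, where they agree.
  obtain ⟨_, ⟨⟨hy1, hy2⟩, hyO⟩, ⟨n, p⟩, rfl⟩ := denseRange_stoneCechUnit.inter_open_nonempty _
    (hV.inter hO1) ⟨z.1, hzV, hzO⟩
  have hmn : m ≤ n := by simpa using hy2
  have hpD : p ∈ D n := by
    have h1 : (1 : ℝ) / (n + 1) ≤ 1 / (m + 1) := by gcongr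
    exact (h1.trans hm.le).trans (le_of_lt hy1)
  have : (⟨stoneCechUnit (n, p), hne n ⟨p, hpD⟩⟩ : {z : BetaSquares // φ z ≠ 0}) ∈
      Subtype.val ⁻¹' O := hyO
  rw [hO2] at this
  exact this ((hH (n, p)).trans (hGh n ⟨p, hpD⟩))

/-- For Hausdorff Y this makes the cozero-set regular Lindelöf, hence normal, so that Tietze's
theorem can be applied on it. -/
theorem sigmaCompactSpace_cozero {Y : Type*} [TopologicalSpace Y] [CompactSpace Y] (φ : C(Y, ℝ)) :
    SigmaCompactSpace {y : Y // φ y ≠ 0} := by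
  have h : {y : Y | φ y ≠ 0} = ⋃ n : ℕ, {y | 1 / ((n : ℝ) + 1) ≤ |φ y|} := by
    ext y
    simp only [mem_ofPred_eq, mem_iUnion]
    constructor
    · intro hy
      obtain ⟨n, hn⟩ := exists_nat_one_div_lt (abs_pos.2 hy)
      exact ⟨n, hn.le⟩
    · rintro ⟨n, hn⟩
      exact abs_pos.1 (lt_of_lt_of_le (by positivity) hn)
  have : IsSigmaCompact {y : Y | φ y ≠ 0} := h ▸ isSigmaCompact_iUnion_of_isCompact _ fun n =>
    (isClosed_le continuous_const φ.continuous.abs).isCompact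
  exact isSigmaCompact_iff_sigmaCompactSpace.1 this

/-- Every closed subspace of the fiber over a free ultrafilter is an `F`-space. -/
theorem isFSpace_of_isClosed_subset_fiber {u : Ultrafilter ℕ} (hu : ∀ n : ℕ, u ≠ pure n)
    {A : Set BetaSquares} (hA : IsClosed A) (hAu : A ⊆ fiber u) : IsFSpace A := by
  intro φ h
  obtain ⟨φ', hφ'⟩ := φ.exists_restrict_eq hA
  have hval (x : A) : φ' x = φ x := DFunLike.congr_fun hφ' x
  have := sigmaCompactSpace_cozero φ'
  let e : {x : A // φ x ≠ 0} → {z : BetaSquares // φ' z ≠ 0} :=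
    fun x => ⟨x.1.1, by rw [hval]; exact x.2⟩
  have he : IsClosedEmbedding e := by
    refine ⟨⟨?_, ?_⟩, ?_⟩
    · have h1 : IsInducing fun x : {x : A // φ x ≠ 0} => x.1.1 :=
        IsInducing.subtypeVal.comp (IsInducing.subtypeVal (t := {x : A | φ x ≠ 0}))
      exact IsInducing.of_comp (by fun_prop) continuous_subtype_val h1
    · intro x y hxy
      exact Subtype.ext (Subtype.ext (congr_arg (fun z => z.1) hxy))
    · have : range e = Subtype.val ⁻¹' A := by
        ext z
        constructor
        · rintro ⟨x, rfl⟩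
          exact x.1.2
        · intro hz
          exact ⟨⟨⟨z.1, hz⟩, by rw [← hval]; exact z.2⟩, rfl⟩
      rw [this]
      exact hA.preimage continuous_subtype_val
  obtain ⟨h', -, hh'⟩ := exists_extension_norm_eq_of_isClosedEmbedding h he
  obtain ⟨H, hH⟩ := exists_continuous_eq_on_fiber hu φ' h'
  have : CompactSpace A := isCompact_iff_compactSpace.1 hA.isCompact
  refine ⟨mkOfCompact (H.restrict A), fun x => ?_⟩
  exact (hH (e x) (hAu x.1.2)).trans (congr_fun hh' x)

end FSpace

/-! ### The decreasing sequence X_α. -/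

section Recursion

theorem mem_removeInteriors {A : Set BetaSquares} {z : BetaSquares} :
    z ∈ removeInteriors A ↔
      z ∈ A ∧ ∀ t : ℝ, ∀ U : Set BetaSquares, IsOpen U → z ∈ U →
        ∃ y ∈ U ∩ A, betaFirst y ≠ t := by
  constructor
  · rintro ⟨hz, hz'⟩
    refine ⟨hz, fun t U hU hzU => ?_⟩
    by_contra! hcon
    refine hz' ⟨⟨z, hz⟩, mem_iUnion.2 ⟨t, mem_interior.2 ⟨Subtype.val ⁻¹' U, ?_,
      hU.preimage continuous_subtype_val, hzU⟩⟩, rfl⟩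
    exact fun y hy => hcon y ⟨hy, y.2⟩
  · rintro ⟨hz, h⟩
    refine ⟨hz, ?_⟩
    rintro ⟨y, hy, rfl⟩
    obtain ⟨t, ht⟩ := mem_iUnion.1 hy
    obtain ⟨V, hV, hVo, hyV⟩ := mem_interior.1 ht
    obtain ⟨U, hU, rfl⟩ := isOpen_induced_iff.1 hVo
    obtain ⟨x, ⟨hxU, hxA⟩, hx⟩ := h t U hU hyV
    exact hx (hV (show (⟨x, hxA⟩ : A) ∈ Subtype.val ⁻¹' U from hxU))

theorem removeInteriors_subset (A : Set BetaSquares) : removeInteriors A ⊆ A := sdiff_subset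

theorem isClosed_removeInteriors {A : Set BetaSquares} (hA : IsClosed A) :
    IsClosed (removeInteriors A) := by
  have h : removeInteriors A =
      Subtype.val '' (Omega fun x : A => betaFirst x)ᶜ := by
    rw [removeInteriors, image_compl_eq_range_sdiff_image Subtype.val_injective,
      Subtype.range_coe]
  rw [h]
  exact hA.isClosedEmbedding_subtypeVal.isClosedMap _
    (isOpen_iUnion fun _ => isOpen_interior).isClosed_compl

/-- A set that is a union of fibers of `collapse`. -/
def Saturated (A : Set BetaSquares) : Prop :=
  ∀ z ∈ A, ∀ z', collapse z' = collapse z → z' ∈ A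

theorem saturated_fiber (u : Ultrafilter ℕ) : Saturated (fiber u) := by
  intro z hz z' h
  rw [fiber, mem_preimage, ← intervalProj_collapse] at *
  rwa [h]

/-- As `collapse` is open, the saturation of a neighborhood of z' is a neighborhood of z. A point of
A found there moves along its fiber into the original neighborhood without leaving A or changing βf.
-/
theorem Saturated.removeInteriors {A : Set BetaSquares} (hA : Saturated A) :
    Saturated (removeInteriors A) := by
  intro z hz z' h
  rw [mem_removeInteriors] at hz ⊢
  refine ⟨hA z hz.1 z' h, fun t U hU hzU => ?_⟩
  obtain ⟨y, ⟨⟨y', hy'U, hy'⟩, hyA⟩, hy⟩ := hz.2 t (collapse ⁻¹' (collapse '' U))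
    ((isOpenMap_collapse U hU).preimage continuous_collapse) ⟨z', hzU, h⟩
  exact ⟨y', ⟨hy'U, hA y hyA y' hy'⟩, betaFirst_eq_of_collapse_eq hy' ▸ hy⟩

theorem X_induction {u : Ultrafilter ℕ} {P : Set BetaSquares → Prop} (h0 : P (fiber u))
    (hs : ∀ A, P A → P (removeInteriors A))
    (hl : ∀ 𝒜 : Set (Set BetaSquares), (∀ A ∈ 𝒜, P A) → P (⋂₀ 𝒜)) (α : Ordinal.{0}) :
    P (X u α) := by
  induction α using Ordinal.limitRecOn with
  | zero => rwa [X_zero]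
  | add_one α ih => rw [X_add_one]; exact hs _ ih
  | limit α hα ih =>
    have : X u α = ⋂₀ (X u '' Iio α) := by
      rw [X_limit u α hα, sInter_image]
      rfl
    rw [this]
    refine hl _ ?_
    rintro _ ⟨β, hβ, rfl⟩
    exact ih β hβ

theorem isClosed_X (u : Ultrafilter ℕ) (α : Ordinal.{0}) : IsClosed (X u α) :=
  X_induction (isClosed_fiber u) (fun _ => isClosed_removeInteriors)
    (fun _ h => isClosed_sInter h) α

theorem saturated_X (u : Ultrafilter ℕ) (α : Ordinal.{0}) : Saturated (X u α) :=
  X_induction (saturated_fiber u) (fun _ => Saturated.removeInteriors)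
    (fun _ h z hz z' hzz' A hA => h A hA z (hz A hA) z' hzz') α

theorem X_antitone (u : Ultrafilter ℕ) : Antitone (X u) := by
  intro α β
  induction β using Ordinal.limitRecOn with
  | zero => intro h; rw [nonpos_iff_eq_zero.1 h]
  | add_one β ih =>
    intro h
    rcases h.eq_or_lt with rfl | h
    · exact le_rfl
    · rw [X_add_one]
      exact (removeInteriors_subset _).trans (ih (Order.lt_add_one_iff.1 h))
  | limit β hβ ih =>
    intro h
    rcases h.eq_or_lt with rfl | h
    · exact le_rfl
    · rw [X_limit u β hβ]
      exact biInter_subset_of_mem (t := X u) h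

theorem X_subset_fiber (u : Ultrafilter ℕ) (α : Ordinal.{0}) : X u α ⊆ fiber u :=
  X_zero u ▸ X_antitone u (zero_le (a := α))

theorem exists_X_eq_X_add_one (u : Ultrafilter ℕ) : ∃ α : Ordinal.{0}, X u α = X u (α + 1) := by
  by_contra! h
  have hanti : StrictAnti (X u) := fun α β hαβ =>
    lt_of_le_of_lt (X_antitone u (Order.add_one_le_of_lt hαβ))
      (lt_of_le_of_ne (X_antitone u (Order.le_succ α)) (h α).symm)
  exact not_injective_of_ordinal (X u) hanti.injective

theorem isLeast_delta (u : Ultrafilter ℕ) :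
    IsLeast {α : Ordinal.{0} | X u α = X u (α + 1)} (delta u) :=
  ⟨csInf_mem (exists_X_eq_X_add_one u), fun _ h => csInf_le' h⟩

/-- If βf is nonconstant on every neighborhood of a point within Y, it is so within any larger set;
hence Y is never cut. -/
theorem subset_X {u : Ultrafilter ℕ} {Y : Set BetaSquares} (hYu : Y ⊆ fiber u)
    (hY : Y ⊆ removeInteriors Y) (α : Ordinal.{0}) : Y ⊆ X u α := by
  refine X_induction (P := fun A => Y ⊆ A) hYu (fun A hA z hz => ?_)
    (fun _ h => subset_sInter h) α
  refine mem_removeInteriors.2 ⟨hA hz, fun t U hU hzU => ?_⟩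
  obtain ⟨y, ⟨hyU, hyY⟩, hy⟩ := (mem_removeInteriors.1 (hY hz)).2 t U hU hzU
  exact ⟨y, ⟨hyU, hA hyY⟩, hy⟩

end Recursion

/-! ### A measure-theoretic set that survives the recursion. -/

section Support

/-- The trace of a subset of `β(ω × [0,1]²)` on the `n`-th square. -/
def trace (n : ℕ) (A : Set BetaSquares) : Set (I × I) := {p | stoneCechUnit (n, p) ∈ A}

/-- The measure of the traces of `A` tends to `0` along `u`. -/
def Negligible (u : Ultrafilter ℕ) (A : Set BetaSquares) : Prop :=
  Tendsto (fun n => (volume : Measure (I × I)) (trace n A)) u (𝓝 0)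

theorem Negligible.mono {u : Ultrafilter ℕ} {A B : Set BetaSquares} (hB : Negligible u B)
    (h : A ⊆ B) : Negligible u A :=
  tendsto_of_tendsto_of_tendsto_of_le_of_le tendsto_const_nhds hB (fun _ => zero_le)
    fun _ => measure_mono fun _ hp => h hp

theorem Negligible.union {u : Ultrafilter ℕ} {A B : Set BetaSquares} (hA : Negligible u A)
    (hB : Negligible u B) : Negligible u (A ∪ B) :=
  tendsto_of_tendsto_of_tendsto_of_le_of_le tendsto_const_nhds
    (by simpa using Tendsto.add hA hB) (fun _ => zero_le)
    fun n => measure_union_le (trace n A) (trace n B)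

theorem negligible_empty (u : Ultrafilter ℕ) : Negligible u ∅ := by
  simp [Negligible, trace]

theorem not_negligible_univ (u : Ultrafilter ℕ) : ¬ Negligible u univ := by
  simp [Negligible, trace]

/-- The points of `β(ω × [0,1]²)` without negligible neighborhoods. -/
def support (u : Ultrafilter ℕ) : Set BetaSquares := {z | ∀ U ∈ 𝓝 z, ¬ Negligible u U}

theorem negligible_of_isCompact {u : Ultrafilter ℕ} {A : Set BetaSquares} (hA : IsCompact A)
    (h : Disjoint A (support u)) : Negligible u A := by
  refine hA.induction_on (negligible_empty u) (fun _ _ hst ht => ht.mono hst)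
    (fun _ _ hs ht => hs.union ht) fun z hz => ?_
  have hz' := disjoint_left.1 h hz
  simp only [support, mem_ofPred_eq, not_forall, not_not] at hz'
  obtain ⟨U, hU, hUn⟩ := hz'
  exact ⟨U, mem_nhdsWithin_of_mem_nhds hU, hUn⟩

/-- Otherwise compactness would make the whole space negligible, although every square has measure
1. -/
theorem support_nonempty (u : Ultrafilter ℕ) : (support u).Nonempty := by
  rw [nonempty_iff_ne_empty]
  intro h
  exact not_negligible_univ u (negligible_of_isCompact isCompact_univ (by simp [h]))

theorem support_subset_fiber (u : Ultrafilter ℕ) : support u ⊆ fiber u := by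
  intro z hz
  by_contra hzu
  obtain ⟨V, V', hV, hV', hzV, huV', hdis⟩ := t2_separation (show betaProj z ≠ u from hzu)
  refine hz _ ((hV.preimage continuous_betaProj).mem_nhds hzV) ?_
  have hev : ∀ᶠ n in (u : Filter ℕ), (pure n : Ultrafilter ℕ) ∈ V' :=
    (Ultrafilter.tendsto_pure_self u).eventually (hV'.mem_nhds huV')
  refine tendsto_const_nhds.congr' (hev.mono fun n hn => ?_)
  have : trace n (betaProj ⁻¹' V) = ∅ := by
    refine eq_empty_of_forall_notMem fun p hp => disjoint_left.1 hdis ?_ hn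
    simpa [trace] using hp
  simp [this]

theorem volume_strip_le (t c : ℝ) :
    (volume : Measure (I × I)) {p | |(p.1 : ℝ) - t| < c} ≤ ENNReal.ofReal (2 * c) := by
  have h : {p : I × I | |(p.1 : ℝ) - t| < c} = {x : I | |(x : ℝ) - t| < c} ×ˢ univ := by
    ext p
    simp
  rw [h, Measure.volume_eq_prod, Measure.prod_prod, measure_univ, mul_one,
    unitInterval.volume_apply]
  calc volume (Subtype.val '' {x : I | |(x : ℝ) - t| < c}) ≤ volume (Ioo (t - c) (t + c)) := by
        refine measure_mono ?_
        rintro _ ⟨x, hx, rfl⟩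
        have := abs_lt.1 (show |(x : ℝ) - t| < c from hx)
        constructor <;> linarith
    _ = ENNReal.ofReal (2 * c) := by rw [Real.volume_Ioo]; ring_nf

theorem support_subset_removeInteriors (u : Ultrafilter ℕ) :
    support u ⊆ removeInteriors (support u) := by
  refine fun z hz => mem_removeInteriors.2 ⟨hz, fun t U hU hzU => ?_⟩
  by_contra! hcon
  obtain ⟨W, hWz, hWc, hWU⟩ := exists_mem_nhds_isClosed_subset (hU.mem_nhds hzU)
  refine hz W hWz (ENNReal.tendsto_nhds_zero.2 fun ε hε => ?_)
  obtain ⟨c, hc, hcε⟩ : ∃ c : ℝ, 0 < c ∧ ENNReal.ofReal (2 * c) ≤ ε / 2 := by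
    obtain ⟨r, hr, hrε⟩ := ENNReal.lt_iff_exists_nnreal_btwn.1 (ENNReal.half_pos hε.ne')
    refine ⟨r / 2, half_pos (by exact_mod_cast hr), ?_⟩
    rw [mul_div_cancel₀ _ two_ne_zero, ENNReal.ofReal_coe_nnreal]
    exact hrε.le
  -- If βf were constantly t on the support inside U, the part of W off the strip |x - t| < c would
  -- be compact and miss the support. The strip itself has measure at most 2c ≤ ε/2, so W would be
  -- negligible.
  have hneg : Negligible u (W ∩ {y | c ≤ |betaFirst y - t|}) := by
    refine negligible_of_isCompact (hWc.inter (isClosed_le continuous_const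
      (continuous_betaFirst.sub continuous_const).abs)).isCompact ?_
    refine disjoint_left.2 fun y hy hyY => ?_
    have h1 : c ≤ |betaFirst y - t| := hy.2
    rw [hcon y ⟨hWU hy.1, hyY⟩, sub_self, abs_zero] at h1
    linarith
  filter_upwards [ENNReal.tendsto_nhds_zero.1 hneg (ε / 2) (ENNReal.half_pos hε.ne')] with n hn
  calc volume (trace n W)
      ≤ volume (trace n (W ∩ {y | c ≤ |betaFirst y - t|}) ∪ {p | |(p.1 : ℝ) - t| < c}) := by
        refine measure_mono fun p hp => ?_
        by_cases h : c ≤ |(p.1 : ℝ) - t|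
        · exact Or.inl ⟨hp, by simpa using h⟩
        · exact Or.inr (not_le.1 h)
    _ ≤ ε / 2 + ε / 2 :=
        (measure_union_le _ _).trans (add_le_add hn ((volume_strip_le t c).trans hcε))
    _ = ε := ENNReal.add_halves ε

end Support

/-! ### The continuum K and the function g. -/

section Continuum

theorem X_delta_nonempty (u : Ultrafilter ℕ) : (X u (delta u)).Nonempty :=
  (support_nonempty u).mono
    (subset_X (support_subset_fiber u) (support_subset_removeInteriors u) _)

theorem removeInteriors_X_delta (u : Ultrafilter ℕ) :
    removeInteriors (X u (delta u)) = X u (delta u) :=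
  (X_add_one u _).symm.trans (isLeast_delta u).1.symm

theorem isClosed_K (u : Ultrafilter ℕ) : IsClosed (K u) :=
  (isClosed_bottomLine u).union (isClosed_X u _)

theorem K_subset_fiber (u : Ultrafilter ℕ) : K u ⊆ fiber u :=
  union_subset inter_subset_left (X_subset_fiber u _)

theorem K_inter_topLine_nonempty (u : Ultrafilter ℕ) : (K u ∩ topLine u).Nonempty := by
  obtain ⟨z, hz⟩ := X_delta_nonempty u
  refine ⟨level 1 (collapse z), Or.inr (saturated_X u _ z hz _ (collapse_level 1 _)),
    level_one_mem_topLine ?_⟩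
  rw [intervalProj_collapse]
  exact X_subset_fiber u _ hz

theorem isConnected_K (u : Ultrafilter ℕ) : IsConnected (K u) := by
  refine ⟨(K_inter_topLine_nonempty u).mono inter_subset_left, ?_⟩
  have hfoot {z : BetaSquares} (hz : z ∈ X u (delta u)) : level 0 (collapse z) ∈ bottomLine u :=
    level_zero_mem_bottomLine ((intervalProj_collapse z).trans (X_subset_fiber u _ hz))
  obtain ⟨z₀, hz₀⟩ := X_delta_nonempty u
  refine isPreconnected_of_forall (level 0 (collapse z₀)) ?_
  rintro z (hz | hz)
  · exact ⟨bottomLine u, subset_union_left, hfoot hz₀, hz, isPreconnected_bottomLine u⟩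
  -- By saturation the whole vertical fiber through z lies in K; it joins z to its foot on the
  -- bottom line.
  · refine ⟨bottomLine u ∪ collapse ⁻¹' {collapse z},
      union_subset_union_right _ fun y hy => saturated_X u _ z hz y hy,
      Or.inl (hfoot hz₀), Or.inr rfl, ?_⟩
    exact (isPreconnected_bottomLine u).union (level 0 (collapse z)) (hfoot hz)
      (collapse_level 0 _) (isPreconnected_collapse_fiber _)

theorem continuous_g (u : Ultrafilter ℕ) : Continuous (g u) :=
  continuous_betaFirst.comp continuous_subtype_val

theorem Omega_g_subset (u : Ultrafilter ℕ) :
    Omega (g u) ⊆ (Subtype.val ⁻¹' bottomLine u : Set (K u)) := by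
  intro z hz
  by_contra hzB
  have hzX : z.1 ∈ X u (delta u) := z.2.resolve_left hzB
  obtain ⟨t, ht⟩ := mem_iUnion.1 hz
  obtain ⟨V, hV, hVo, hzV⟩ := mem_interior.1 ht
  obtain ⟨U, hU, rfl⟩ := isOpen_induced_iff.1 hVo
  have hmem := hzX
  rw [← removeInteriors_X_delta u] at hmem
  obtain ⟨y, ⟨hyU, hyX⟩, hy⟩ := (mem_removeInteriors.1 hmem).2 t U hU hzV
  exact hy (hV (show (⟨y, Or.inr hyX⟩ : K u) ∈ Subtype.val ⁻¹' U from hyU))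

theorem not_dense_bottomLine (u : Ultrafilter ℕ) :
    ¬ Dense (Subtype.val ⁻¹' bottomLine u : Set (K u)) := by
  intro h
  obtain ⟨z, hzK, hzT⟩ := K_inter_topLine_nonempty u
  have hz : (⟨z, hzK⟩ : K u) ∈ (Subtype.val ⁻¹' bottomLine u : Set (K u)) := by
    have := h ⟨z, hzK⟩
    rwa [((isClosed_bottomLine u).preimage continuous_subtype_val).closure_eq] at this
  exact disjoint_left.1 (disjoint_bottomLine_topLine u) hz hzT

theorem not_dense_Omega_g (u : Ultrafilter ℕ) : ¬ Dense (Omega (g u)) :=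
  fun h => not_dense_bottomLine u (h.mono (Omega_g_subset u))

theorem isFSpace_K {u : Ultrafilter ℕ} (hu : ∀ n : ℕ, u ≠ pure n) : IsFSpace (K u) :=
  isFSpace_of_isClosed_subset_fiber hu (isClosed_K u) (K_subset_fiber u)

theorem hyperfilter_ne_pure (n : ℕ) : hyperfilter ℕ ≠ pure n := by
  intro h
  have h1 : ({n} : Set ℕ) ∈ hyperfilter ℕ := by rw [h]; exact mem_singleton n
  exact (finite_singleton n).notMem_hyperfilter h1

end Continuum

end ConnectedFSpace

end

theorem mainTheorem1 :
    (∀ u : Ultrafilter ℕ, (∀ n : ℕ, u ≠ pure n) →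
      -- the recursion becomes constant, and `δ` is the first place where it does
      IsLeast {α : Ordinal.{0} | ConnectedFSpace.X u α = ConnectedFSpace.X u (α + 1)}
        (ConnectedFSpace.delta u) ∧
      -- `K` is a compact connected `F`-space inside `S_u`
      ConnectedFSpace.K u ⊆ ConnectedFSpace.fiber u ∧
      CompactSpace (ConnectedFSpace.K u) ∧
      T2Space (ConnectedFSpace.K u) ∧
      ConnectedSpace (ConnectedFSpace.K u) ∧
      ConnectedFSpace.IsFSpace (ConnectedFSpace.K u) ∧
      -- `K` reaches the top line
      (ConnectedFSpace.K u ∩ ConnectedFSpace.topLine u).Nonempty ∧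
      -- `g` is continuous, `Ω_g ⊆ B_u`, and neither of these sets is dense in `K`
      Continuous (ConnectedFSpace.g u) ∧
      ConnectedFSpace.Omega (ConnectedFSpace.g u) ⊆
        (Subtype.val ⁻¹' ConnectedFSpace.bottomLine u : Set (ConnectedFSpace.K u)) ∧
      ¬ Dense (Subtype.val ⁻¹' ConnectedFSpace.bottomLine u : Set (ConnectedFSpace.K u)) ∧
      ¬ Dense (ConnectedFSpace.Omega (ConnectedFSpace.g u))) ∧
    -- the positive answer to the problem of Abramovich and Kitover
    (∃ (K : Type) (_ : TopologicalSpace K) (f : C(K, ℝ)),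
      CompactSpace K ∧ T2Space K ∧ ConnectedSpace K ∧ ConnectedFSpace.IsFSpace K ∧
      ¬ Dense (ConnectedFSpace.Omega f)) := by
  refine ⟨fun u hu => ⟨ConnectedFSpace.isLeast_delta u, ConnectedFSpace.K_subset_fiber u,
    isCompact_iff_compactSpace.1 (ConnectedFSpace.isClosed_K u).isCompact, inferInstance,
    isConnected_iff_connectedSpace.1 (ConnectedFSpace.isConnected_K u),
    ConnectedFSpace.isFSpace_K hu, ConnectedFSpace.K_inter_topLine_nonempty u,
    ConnectedFSpace.continuous_g u, ConnectedFSpace.Omega_g_subset u,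
    ConnectedFSpace.not_dense_bottomLine u, ConnectedFSpace.not_dense_Omega_g u⟩, ?_⟩
  let u := Filter.hyperfilter ℕ
  exact ⟨ConnectedFSpace.K u, inferInstance, ⟨ConnectedFSpace.g u, ConnectedFSpace.continuous_g u⟩,
    isCompact_iff_compactSpace.1 (ConnectedFSpace.isClosed_K u).isCompact, inferInstance,
    isConnected_iff_connectedSpace.1 (ConnectedFSpace.isConnected_K u),
    ConnectedFSpace.isFSpace_K ConnectedFSpace.hyperfilter_ne_pure,
    ConnectedFSpace.not_dense_Omega_g u⟩
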